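/- Let $\mathbb{F}$ be a field and $n\in\mathbb{N}$. An $n$-parameter persistence module is a functor $M:\mathbf{R}^n\to\mathbf{Vect}_{\mathbb F}$, where $\mathbf{R}^n$ is the poset $\mathbb{R}^n$ with the coordinatewise order. It is finitely presented if $M\cong \mathrm{Free}[\mathcal X]/\langle\mathcal R\rangle$ for a finite $\mathbb{R}^n$-graded set $\mathcal X$ and a finite family $\mathcal R$ of homogeneous elements of the free module on $\mathcal X$. For $\varepsilon\ge 0$ let $T_\varepsilon(\vec a)=\vec a+\varepsilon\vec 1$. The modules $M,N$ are $\varepsilon$-interleaved if there are natural transformations $f:M\Rightarrow NT_\varepsilon$ and $g:N\Rightarrow MT_\varepsilon$ whose composites $M\Rightarrow MT_{2\varepsilon}$ and $N\Rightarrow NT_{2\varepsilon}$ are the internal translations, and $d_I(M,N)=\inf\{\varepsilon\ge 0: M,N\text{ are }\varepsilon\text{-interleaved}\}\in[0,\infty]$. For a graded set $\mathcal X$ write $\mathcal X(s)$ for the same set with every grade $\vec a$ replaced by $\vec a-s\vec 1$. The space of finitely presented $n$-parameter persistence modules with the interleaving distance is an extended metric space up to isomorphism, and it is a path metric space. That is: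 1. $d_I$ is an extended pseudometric on finitely presented modules, and $d_I(M,N)=0$ if and only if $M\cong N$. 2. For all finitely presented $M,N$, $d_I(M,N)$ is the infimum of the lengths $\ell(\gamma)=\sup_{0=t_0<\dots<t_k=1}\sum_{i=1}^{k} d_I(\gamma(t_{i-1}),\gamma(t_i))$ over all $d_I$-continuous paths $\gamma$ of finitely presented modules from $M$ to $N$ (the infimum of the empty set being $\infty$). 3. If $M,N$ are finitely presented and $d_I(M,N)=\varepsilon<\infty$, then $M$ and $N$ are joined by a $d_I$-continuous path $\gamma$ of finitely presented modules of length exactly $\varepsilon$. Moreover $\gamma$ can be chosen so that there are finite graded sets $\mathcal X_M,\mathcal X_N$ and finite families $\mathcal R_M$ and $\mathcal R_N$ of homogeneous elements of $\mathrm{Free}[\mathcal X_M\sqcup\mathcal X_N(-\varepsilon)]$ and $\mathrm{Free}[\mathcal X_M(-\varepsilon)\sqcup\mathcal X_N]$, respectively, with $$\gamma(t)\cong\langle \mathcal X_M(-t\varepsilon),\ \mathcal X_N((t-1)\varepsilon)\ |\ \mathcal R_M(-t\varepsilon),\ \mathcal R_N((t-1)\varepsilon)\rangle\qquad\text{for all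 } t\in[0,1].$$ -/

import Mathlib

open CategoryTheory
open scoped NNReal ENNReal unitInterval

universe u

/-- The poset `ℝⁿ` with the coordinatewise order, regarded as a category through this order. -/
def Grade (n : ℕ) : Type := Fin n → ℝ

instance (n : ℕ) : PartialOrder (Grade n) := inferInstanceAs (PartialOrder (Fin n → ℝ))

/-- The category `Vect^{ℝⁿ}` of `n`-parameter persistence modules over the field `F`: functors from
the poset `ℝⁿ` (with the coordinatewise order) to vector spaces over `F`. -/
abbrev PersModule (F : Type u) [Field F] (n : ℕ) := Grade n ⥤ ModuleCat.{u} F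

/-- The grade `a` translated by `ε • (1, …, 1)`. -/
noncomputable def shiftGrade {n : ℕ} (ε : ℝ) (a : Grade n) : Grade n := fun i => a i + ε

theorem shiftGrade_mono {n : ℕ} (ε : ℝ) {a b : Grade n} (h : a ≤ b) :
    shiftGrade ε a ≤ shiftGrade ε b := fun i => by
  have := h i
  simp only [shiftGrade]; linarith

theorem le_shiftGrade_shiftGrade {n : ℕ} (ε : ℝ≥0) (a : Grade n) :
    a ≤ shiftGrade ε (shiftGrade ε a) := fun i => by
  have := ε.2
  simp only [shiftGrade]; linarith [ε.coe_nonneg]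

/-- The translation endofunctor `T_ε` of the poset category `ℝⁿ`. -/
noncomputable abbrev translation (n : ℕ) (ε : ℝ) : Grade n ⥤ Grade n where
  obj a := shiftGrade ε a
  map h := homOfLE (shiftGrade_mono ε (leOfHom h))

section Interleaving

variable {F : Type u} [Field F] {n : ℕ}

/-- `M` and `N` are `ε`-interleaved: there are natural transformations `f : M ⟶ N T_ε` and
`g : N ⟶ M T_ε` whose two composites are the internal translations by `2ε`. -/
def Interleaved (ε : ℝ≥0) (M N : PersModule F n) : Prop :=
  ∃ (f : M ⟶ translation n ε ⋙ N) (g : N ⟶ translation n ε ⋙ M),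
    (∀ a : Grade n,
      f.app a ≫ g.app (shiftGrade ε a) = M.map (homOfLE (le_shiftGrade_shiftGrade ε a))) ∧
    (∀ a : Grade n,
      g.app a ≫ f.app (shiftGrade ε a) = N.map (homOfLE (le_shiftGrade_shiftGrade ε a)))

/-- The interleaving distance, with value `⊤` if `M` and `N` are not `ε`-interleaved for any `ε`. -/
noncomputable def interleavingDist (M N : PersModule F n) : ℝ≥0∞ :=
  ⨅ (ε : ℝ≥0) (_ : Interleaved ε M N), (ε : ℝ≥0∞)

end Interleaving

section Presentations

/-- A presentation `⟨X | R⟩`: a graded set `X` of generators together with a (graded) family `R` of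
homogeneous elements of the free module on `X`. In degree `a` the free module on `X` has a basis
consisting of the monomial multiples (of degree `a`) of those generators `x` with `gr x ≤ a`, so a
homogeneous element of degree `a` is given by a finitely supported coefficient vector whose support
consists of generators of grade at most `a`. -/
structure Presentation (F : Type u) [Field F] (n : ℕ) where
  Gen : Type
  Rel : Type
  grGen : Gen → Grade n
  grRel : Rel → Grade n
  rel : Rel → Gen →₀ F
  rel_mem : ∀ r, rel r ∈ Finsupp.supported F F {x | grGen x ≤ grRel r}

namespace Presentation

variable {F : Type u} [Field F] {n : ℕ} (P : Presentation F n)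

/-- The vector space of all finitely supported coefficient vectors on the generators. -/
def Coeff (P : Presentation F n) : Type u := P.Gen →₀ F

noncomputable instance : AddCommGroup P.Coeff := inferInstanceAs (AddCommGroup (P.Gen →₀ F))

noncomputable instance : Module F P.Coeff := inferInstanceAs (Module F (P.Gen →₀ F))

/-- The degree `a` part of the free module on the generators, as coefficient vectors. The structure
maps between the degrees are the inclusions. -/
noncomputable def free (a : Grade n) : Submodule F P.Coeff :=
  Finsupp.supported F F {x | P.grGen x ≤ a}

theorem free_mono {a b : Grade n} (h : a ≤ b) : P.free a ≤ P.free b :=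
  Finsupp.supported_mono fun _ hx => le_trans hx h

/-- The degree `a` part of the submodule generated by the relations: it is spanned by the monomial
multiples (of degree `a`) of the relations of grade at most `a`. -/
noncomputable def relSpan (a : Grade n) : Submodule F P.Coeff :=
  Submodule.span F ((P.rel : P.Rel → P.Coeff) '' {r | P.grRel r ≤ a})

theorem relSpan_mono {a b : Grade n} (h : a ≤ b) : P.relSpan a ≤ P.relSpan b :=
  Submodule.span_mono (Set.image_mono fun _ hr => le_trans hr h)

/-- The relations of degree `a` do lie in the degree `a` part of the free module. -/
theorem relSpan_le_free (a : Grade n) : P.relSpan a ≤ P.free a := by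
  refine Submodule.span_le.2 ?_
  rintro _ ⟨r, hr, rfl⟩
  exact P.free_mono hr (P.rel_mem r)

/-- The relations of degree `a`, as a submodule of the degree `a` part of the free module. -/
noncomputable def relIn (a : Grade n) : Submodule F (P.free a) :=
  (P.relSpan a).comap (P.free a).subtype

theorem relIn_le_comap {a b : Grade n} (h : a ≤ b) :
    P.relIn a ≤ (P.relIn b).comap (Submodule.inclusion (P.free_mono h)) := by
  intro x hx
  exact P.relSpan_mono h hx

/-- The persistence module `Free[X] / ⟨R⟩`. -/
noncomputable def toModule : PersModule F n where
  obj a := ModuleCat.of F (P.free a ⧸ P.relIn a)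
  map h := ModuleCat.ofHom
    (Submodule.mapQ _ _ (Submodule.inclusion (P.free_mono (leOfHom h)))
      (P.relIn_le_comap (leOfHom h)))
  map_id a := by
    ext x
    rfl
  map_comp h k := by
    ext x
    rfl

end Presentation

/-- `M` is finitely presented: it is isomorphic to `Free[X] / ⟨R⟩` with `X` and `R` finite. -/
def isFinitelyPresented (F : Type u) [Field F] (n : ℕ) : ObjectProperty (PersModule F n) :=
  fun M => ∃ P : Presentation F n, Finite P.Gen ∧ Finite P.Rel ∧ Nonempty (M ≅ P.toModule)

/-- The category of finitely presented `n`-parameter persistence modules. -/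
abbrev FinPresModule (F : Type u) [Field F] (n : ℕ) := (isFinitelyPresented F n).FullSubcategory

/-- Graded sets `X_M`, `X_N` and families `R_M`, `R_N` of homogeneous elements of
`Free[X_M ⊔ X_N(-ε)]` and of `Free[X_M(-ε) ⊔ X_N]`, respectively. Here `X(-ε)` is the graded set `X`
with all grades increased by `ε • (1, …, 1)`. -/
structure JointPresentation (F : Type u) [Field F] (n : ℕ) (ε : ℝ≥0) where
  GenM : Type
  GenN : Type
  RelM : Type
  RelN : Type
  grGenM : GenM → Grade n
  grGenN : GenN → Grade n
  grRelM : RelM → Grade n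
  grRelN : RelN → Grade n
  relM : RelM → (GenM ⊕ GenN) →₀ F
  relN : RelN → (GenM ⊕ GenN) →₀ F
  relM_mem : ∀ r, relM r ∈ Finsupp.supported F F
    {x | Sum.elim grGenM (fun y => shiftGrade ε (grGenN y)) x ≤ grRelM r}
  relN_mem : ∀ r, relN r ∈ Finsupp.supported F F
    {x | Sum.elim (fun y => shiftGrade ε (grGenM y)) grGenN x ≤ grRelN r}

namespace JointPresentation

variable {F : Type u} [Field F] {n : ℕ} {ε : ℝ≥0}

/-- The interpolated presentation
`⟨X_M(-tε), X_N((t-1)ε) | R_M(-tε), R_N((t-1)ε)⟩` for `t ∈ [0,1]`. -/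
noncomputable def interpolate (D : JointPresentation F n ε) (t : I) : Presentation F n where
  Gen := D.GenM ⊕ D.GenN
  Rel := D.RelM ⊕ D.RelN
  grGen := Sum.elim (fun x => shiftGrade (t * ε) (D.grGenM x))
    (fun y => shiftGrade ((1 - t) * ε) (D.grGenN y))
  grRel := Sum.elim (fun r => shiftGrade (t * ε) (D.grRelM r))
    (fun r => shiftGrade ((1 - t) * ε) (D.grRelN r))
  rel := Sum.elim D.relM D.relN
  rel_mem := by
    have h0 : 0 ≤ (t : ℝ) * ε := mul_nonneg t.2.1 ε.coe_nonneg
    have h1 : 0 ≤ (1 - (t : ℝ)) * ε := mul_nonneg (sub_nonneg.2 t.2.2) ε.coe_nonneg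
    rintro (r | r)
    · refine Finsupp.supported_mono ?_ (D.relM_mem r)
      rintro (x | y) h i
      · have := h i
        simp only [Sum.elim_inl, shiftGrade] at this ⊢
        linarith
      · have := h i
        simp only [Sum.elim_inl, Sum.elim_inr, shiftGrade] at this ⊢
        nlinarith
    · refine Finsupp.supported_mono ?_ (D.relN_mem r)
      rintro (x | y) h i
      · have := h i
        simp only [Sum.elim_inl, Sum.elim_inr, shiftGrade] at this ⊢
        nlinarith
      · have := h i
        simp only [Sum.elim_inr, shiftGrade] at this ⊢
        linarith

end JointPresentation

end Presentations

section Distance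

variable {F : Type u} [Field F] {n : ℕ}

theorem Interleaved.refl (M : PersModule F n) : Interleaved 0 M M := by
  have h : ∀ a : Grade n, a ≤ shiftGrade ((0 : ℝ≥0) : ℝ) a := fun a i => by simp [shiftGrade]
  let f : M ⟶ translation n ((0 : ℝ≥0) : ℝ) ⋙ M :=
    { app := fun a => M.map (Y := (translation n ((0 : ℝ≥0) : ℝ)).obj a) (homOfLE (h a))
      naturality := fun a b k => by
        simp only [Functor.comp_map, ← M.map_comp]
        rfl }
  exact ⟨f, f, fun a => (M.map_comp (homOfLE (h a)) (homOfLE (h _))).symm,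
    fun a => (M.map_comp (homOfLE (h a)) (homOfLE (h _))).symm⟩

theorem Interleaved.symm {ε : ℝ≥0} {M N : PersModule F n} (h : Interleaved ε M N) :
    Interleaved ε N M := by
  obtain ⟨f, g, h1, h2⟩ := h
  exact ⟨g, f, h2, h1⟩

theorem shiftGrade_shiftGrade_le {n : ℕ} {ε δ η : ℝ≥0} (h : η = ε + δ) (a : Grade n) :
    shiftGrade δ (shiftGrade ε a) ≤ shiftGrade η a := fun i => by
  subst h
  simp only [shiftGrade, NNReal.coe_add]; linarith

theorem comp_aux_one {C : Type*} [Category C] {A A' B B' D D' E E' : C} (m : A ⟶ A')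
    (fa : A ⟶ B) (fb : A' ⟶ B') (p : B ⟶ B') (ga : B ⟶ D) (gb : B' ⟶ D') (q : D ⟶ D')
    (la : D ⟶ E) (lb : D' ⟶ E') (r : E ⟶ E') (h₁ : m ≫ fb = fa ≫ p) (h₂ : p ≫ gb = ga ≫ q)
    (h₃ : q ≫ lb = la ≫ r) : m ≫ fb ≫ gb ≫ lb = (fa ≫ ga ≫ la) ≫ r := by
  rw [reassoc_of% h₁, reassoc_of% h₂, h₃]
  simp only [Category.assoc]

theorem map_comp_four {C D : Type*} [Category C] [Category D] (M : C ⥤ D) {a b c d e : C}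
    (f : a ⟶ b) (g : b ⟶ c) (h : c ⟶ d) (k : d ⟶ e) :
    M.map f ≫ M.map g ≫ M.map h ≫ M.map k = M.map (f ≫ g ≫ h ≫ k) := by
  simp only [M.map_comp]

theorem comp_aux_two {C : Type*} [Category C] {Ma Mb Mc Md Me Nb Nc Nd Lc Ld : C}
    (fa : Ma ⟶ Nb) (gb : Nb ⟶ Lc) (l : Lc ⟶ Ld) (gd : Ld ⟶ Nd) (fd : Nd ⟶ Md) (m : Md ⟶ Me)
    (gc : Lc ⟶ Nc) (p : Nc ⟶ Nd) (fc : Nc ⟶ Mc) (m' : Mc ⟶ Md) (q : Nb ⟶ Nc) (fb : Nb ⟶ Mb)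
    (m'' : Mb ⟶ Mc) (m₀ : Ma ⟶ Mb) (n₁ : l ≫ gd = gc ≫ p) (n₂ : p ≫ fd = fc ≫ m')
    (n₃ : q ≫ fc = fb ≫ m'') (hb : gb ≫ gc = q) (ha : fa ≫ fb = m₀) :
    (fa ≫ gb ≫ l) ≫ (gd ≫ fd ≫ m) = m₀ ≫ m'' ≫ m' ≫ m := by
  simp only [Category.assoc]
  rw [reassoc_of% n₁, reassoc_of% n₂, reassoc_of% hb, reassoc_of% n₃, reassoc_of% ha]

/-- The composite `M ⟶ N T_ε ⟶ L T_δ T_ε = L T_η` for `η = ε + δ`. -/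
noncomputable def interleavingComp {ε δ η : ℝ≥0} (hη : η = ε + δ) {M N L : PersModule F n}
    (f : M ⟶ translation n ε ⋙ N) (g : N ⟶ translation n δ ⋙ L) : M ⟶ translation n η ⋙ L where
  app a := f.app a ≫ g.app (shiftGrade ε a) ≫ L.map (homOfLE (shiftGrade_shiftGrade_le hη a))
  naturality a b k := by
    have hL : L.map ((translation n δ).map ((translation n ε).map k)) ≫
        L.map (homOfLE (shiftGrade_shiftGrade_le hη b)) =
        L.map (homOfLE (shiftGrade_shiftGrade_le hη a)) ≫ L.map ((translation n η).map k) :=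
      (L.map_comp _ _).symm.trans (L.map_comp (homOfLE (shiftGrade_shiftGrade_le hη a))
        ((translation n η).map k))
    exact comp_aux_one _ _ _ _ _ _ _ _ _ _ (f.naturality k)
      (g.naturality ((translation n ε).map k)) hL

theorem interleavingComp_comp {ε δ η : ℝ≥0} (h₁ : η = ε + δ) (h₂ : η = δ + ε)
    {M N L : PersModule F n}
    (f : M ⟶ translation n ε ⋙ N) (f' : N ⟶ translation n ε ⋙ M)
    (g : N ⟶ translation n δ ⋙ L) (g' : L ⟶ translation n δ ⋙ N)
    (hf : ∀ a : Grade n,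
      f.app a ≫ f'.app (shiftGrade ε a) = M.map (homOfLE (le_shiftGrade_shiftGrade ε a)))
    (hg : ∀ a : Grade n,
      g.app a ≫ g'.app (shiftGrade δ a) = N.map (homOfLE (le_shiftGrade_shiftGrade δ a)))
    (a : Grade n) :
    (interleavingComp h₁ f g).app a ≫ (interleavingComp h₂ g' f').app (shiftGrade η a) =
      M.map (homOfLE (le_shiftGrade_shiftGrade η a)) := by
  have e₁ := shiftGrade_shiftGrade_le h₁ a
  have e₂ := shiftGrade_shiftGrade_le h₂ (shiftGrade η a)
  let b : Grade n := shiftGrade ε a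
  let c : Grade n := shiftGrade δ b
  let d : Grade n := shiftGrade η a
  have e₃ : shiftGrade δ c ≤ shiftGrade δ d := shiftGrade_mono δ e₁
  have e₄ : shiftGrade ε (shiftGrade δ c) ≤ shiftGrade ε (shiftGrade δ d) := shiftGrade_mono ε e₃
  have e₅ : b ≤ shiftGrade δ c := le_shiftGrade_shiftGrade δ b
  have n₁ : L.map (homOfLE e₁) ≫ g'.app d = g'.app c ≫ N.map (homOfLE e₃) :=
    g'.naturality (homOfLE e₁)
  have n₂ : N.map (homOfLE e₃) ≫ f'.app (shiftGrade δ d) =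
      f'.app (shiftGrade δ c) ≫ M.map (homOfLE e₄) := f'.naturality (homOfLE e₃)
  have n₃ : N.map (homOfLE e₅) ≫ f'.app (shiftGrade δ c) =
      f'.app b ≫ M.map (homOfLE (shiftGrade_mono ε e₅)) := f'.naturality (homOfLE e₅)
  have hb : g.app b ≫ g'.app c = N.map (homOfLE e₅) := hg b
  have ha : f.app a ≫ f'.app b = M.map (homOfLE (le_shiftGrade_shiftGrade ε a)) := hf a
  have key := comp_aux_two _ _ _ _ _ (M.map (homOfLE e₂)) _ _ _ _ _ _ _ _ n₁ n₂ n₃ hb ha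
  exact key.trans (map_comp_four M _ _ _ _)

theorem Interleaved.trans {ε δ : ℝ≥0} {M N L : PersModule F n} (h : Interleaved ε M N)
    (k : Interleaved δ N L) : Interleaved (ε + δ) M L := by
  obtain ⟨f, f', hf, hf'⟩ := h
  obtain ⟨g, g', hg, hg'⟩ := k
  exact ⟨interleavingComp rfl f g, interleavingComp (add_comm _ _) g' f',
    interleavingComp_comp rfl (add_comm _ _) f f' g g' hf hg,
    interleavingComp_comp (add_comm _ _) rfl g' g f' f hg' hf'⟩

theorem interleavingDist_self (M : PersModule F n) : interleavingDist M M = 0 :=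
  le_antisymm (iInf₂_le (0 : ℝ≥0) (Interleaved.refl M)) bot_le

theorem interleavingDist_comm (M N : PersModule F n) :
    interleavingDist M N = interleavingDist N M :=
  le_antisymm (le_iInf₂ fun ε h => iInf₂_le ε h.symm) (le_iInf₂ fun ε h => iInf₂_le ε h.symm)

theorem interleavingDist_triangle (M N L : PersModule F n) :
    interleavingDist M L ≤ interleavingDist M N + interleavingDist N L := by
  unfold interleavingDist
  simp only [ENNReal.iInf_add, ENNReal.add_iInf]
  refine le_iInf₂ fun ε h => le_iInf₂ fun δ k => ?_
  exact (iInf₂_le (δ + ε) (k.trans h)).trans (by simp)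

/-- The (extended pseudo-)metric on finitely presented modules given by the interleaving distance;
the topology is the one induced by this distance. -/
noncomputable instance : PseudoEMetricSpace (FinPresModule F n) where
  edist M N := interleavingDist M.obj N.obj
  edist_self M := interleavingDist_self M.obj
  edist_comm M N := interleavingDist_comm M.obj N.obj
  edist_triangle M N L := interleavingDist_triangle M.obj N.obj L.obj

end Distance

section PathMetric

variable {X : Type*} [PseudoEMetricSpace X]

/-- The length of a path `γ : [0,1] → X`: the supremum of `∑ d(γ(tᵢ₋₁), γ(tᵢ))` over all finite
monotone sequences in `[0,1]`. -/
noncomputable def pathLength {x y : X} (γ : Path x y) : ℝ≥0∞ := eVariationOn γ Set.univ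

/-- The distance between any two points is the infimum of the lengths of the paths joining them. -/
def IsPathMetric (X : Type*) [PseudoEMetricSpace X] : Prop :=
  ∀ x y : X, edist x y = ⨅ γ : Path x y, pathLength γ

end PathMetric

/-! A morphism from `Free[X]/⟨R⟩` into a translate of another presented module lifts to a linear map
of coefficient vectors, since free modules are projective. An `ε`-interleaving thus becomes a pair
`φ`, `ψ` of such maps that raise grades by `ε` and are mutually inverse modulo relations in grades
raised by `2ε` (`interleaved_iff`).

Take the generators and relations of both modules, and add `y = ψ y` and `x = φ x` as relations
(`joint`). At `t = 0` the first kind eliminates every `y`, and all other added relations become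
consequences of those of `P`, so the module is that of `P`; `t = 1` is symmetric
(`iso_of_elimination`). Coefficients do not depend on `t`, only grades do, so the identity
interleaves times `s` and `t` by `|s - t|ε` (`interpolate_interleaved`). The path is `ε`-Lipschitz
and its length is at most `ε`.

For this to give length exactly the distance, the infimum defining the distance must be attained
(`interleaved_of_interleavingDist_le`). Finitely many grades occur, so for `δ` slightly above `ε` no
more generators or relations are available than at `ε`, and a `δ`-interleaving is already an
`ε`-interleaving. The case `ε = 0` gives an isomorphism. -/

namespace Presentation

variable {F : Type u} [Field F] {n : ℕ}

/-! ### Linear algebra of coefficient vectors -/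

section Lifts

/-- The coefficient vector of a generator. -/
noncomputable def gen (P : Presentation F n) (x : P.Gen) : P.Coeff := Finsupp.single x (1 : F)

/-- The linear map on coefficient vectors with prescribed values on the generators. -/
noncomputable def lift (P : Presentation F n) {V : Type*} [AddCommGroup V] [Module F V]
    (v : P.Gen → V) : P.Coeff →ₗ[F] V :=
  (Finsupp.linearCombination F v : (P.Gen →₀ F) →ₗ[F] V)

@[simp] theorem lift_gen (P : Presentation F n) {V : Type*} [AddCommGroup V] [Module F V]
    (v : P.Gen → V) (x : P.Gen) : P.lift v (P.gen x) = v x := by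
  have h : Finsupp.linearCombination F v (Finsupp.single x (1 : F)) = v x := by simp
  exact h

theorem free_eq_span (P : Presentation F n) (a : Grade n) :
    P.free a = Submodule.span F (P.gen '' {x | P.grGen x ≤ a}) :=
  Finsupp.supported_eq_span_single F _

theorem gen_mem_free (P : Presentation F n) {x : P.Gen} {a : Grade n} (h : P.grGen x ≤ a) :
    P.gen x ∈ P.free a := by
  rw [free_eq_span]
  exact Submodule.subset_span ⟨x, h, rfl⟩

theorem rel_mem_relSpan (P : Presentation F n) {r : P.Rel} {a : Grade n} (h : P.grRel r ≤ a) :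
    (P.rel r : P.Coeff) ∈ P.relSpan a :=
  Submodule.subset_span ⟨r, h, rfl⟩

theorem free_le_of_gen (P : Presentation F n) {a : Grade n} {S : Submodule F P.Coeff}
    (h : ∀ x, P.grGen x ≤ a → P.gen x ∈ S) : P.free a ≤ S := by
  rw [free_eq_span, Submodule.span_le]
  rintro _ ⟨x, hx, rfl⟩
  exact h x hx

theorem relSpan_le_of_rel (P : Presentation F n) {a : Grade n} {S : Submodule F P.Coeff}
    (h : ∀ r, P.grRel r ≤ a → (P.rel r : P.Coeff) ∈ S) : P.relSpan a ≤ S := by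
  rw [relSpan, Submodule.span_le]
  rintro _ ⟨x, hx, rfl⟩
  exact h x hx

theorem free_le_free {P : Presentation F n} {a b : Grade n}
    (h : ∀ x, P.grGen x ≤ a → P.grGen x ≤ b) : P.free a ≤ P.free b :=
  P.free_le_of_gen fun x hx => P.gen_mem_free (h x hx)

theorem relSpan_le_relSpan {P : Presentation F n} {a b : Grade n}
    (h : ∀ r, P.grRel r ≤ a → P.grRel r ≤ b) : P.relSpan a ≤ P.relSpan b :=
  P.relSpan_le_of_rel fun r hr => P.rel_mem_relSpan (h r hr)

end Lifts

/-! ### Morphisms and interleavings as maps of coefficient vectors -/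

/-- `φ` maps generators and relations of `P` to homogeneous elements and consequences of relations
of `Q`, raising degrees by `ε`. -/
structure IsShiftMap (P Q : Presentation F n) (ε : ℝ) (φ : P.Coeff →ₗ[F] Q.Coeff) : Prop where
  gen_mem : ∀ x, φ (P.gen x) ∈ Q.free (shiftGrade ε (P.grGen x))
  rel_mem : ∀ r, φ (P.rel r) ∈ Q.relSpan (shiftGrade ε (P.grRel r))

variable {P Q : Presentation F n} {ε : ℝ} {φ : P.Coeff →ₗ[F] Q.Coeff}

theorem IsShiftMap.free_le (h : IsShiftMap P Q ε φ) (a : Grade n) :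
    P.free a ≤ (Q.free (shiftGrade ε a)).comap φ :=
  P.free_le_of_gen fun x hx => Q.free_mono (shiftGrade_mono ε hx) (h.gen_mem x)

theorem IsShiftMap.relSpan_le (h : IsShiftMap P Q ε φ) (a : Grade n) :
    P.relSpan a ≤ (Q.relSpan (shiftGrade ε a)).comap φ :=
  P.relSpan_le_of_rel fun r hr => Q.relSpan_mono (shiftGrade_mono ε hr) (h.rel_mem r)

/-- The class in `P.toModule` of a homogeneous element of degree `a`. -/
noncomputable def cls (P : Presentation F n) (a : Grade n) (u : P.free a) : P.toModule.obj a :=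
  (P.relIn a).mkQ u

theorem cls_surjective (P : Presentation F n) (a : Grade n) : Function.Surjective (P.cls a) :=
  (P.relIn a).mkQ_surjective

theorem cls_eq_iff {a : Grade n} {u v : P.free a} :
    P.cls a u = P.cls a v ↔ (u : P.Coeff) - v ∈ P.relSpan a :=
  Submodule.Quotient.eq (P.relIn a)

/-- The morphism of modules that an `IsShiftMap` induces. -/
noncomputable def IsShiftMap.hom (h : IsShiftMap P Q ε φ) :
    P.toModule ⟶ translation n ε ⋙ Q.toModule where
  app a := ModuleCat.ofHom (Submodule.mapQ (P.relIn a) (Q.relIn (shiftGrade ε a))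
    (φ.restrict (h.free_le a)) fun u hu => h.relSpan_le a hu)
  naturality a b k := by
    ext x
    obtain ⟨u, rfl⟩ := P.cls_surjective a x
    rfl

/-- Projectivity of the free module: representatives of the images of the generators determine a
lift, and naturality of `f` carries it to all degrees. -/
theorem exists_isShiftMap (f : P.toModule ⟶ translation n ε ⋙ Q.toModule) :
    ∃ (φ : P.Coeff →ₗ[F] Q.Coeff) (h : IsShiftMap P Q ε φ), f = h.hom := by
  choose v hv using fun x : P.Gen => Q.cls_surjective (shiftGrade ε (P.grGen x))
    (f.app (P.grGen x) (P.cls (P.grGen x) ⟨P.gen x, P.gen_mem_free le_rfl⟩))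
  have hfree : ∀ a, P.free a ≤ (Q.free (shiftGrade ε a)).comap (P.lift fun x => (v x : Q.Coeff)) :=
    fun a => P.free_le_of_gen fun x hx => by
      rw [Submodule.mem_comap, lift_gen]
      exact Q.free_mono (shiftGrade_mono ε hx) (v x).2
  have hgen : ∀ (a : Grade n) (x : P.Gen) (hx : P.grGen x ≤ a),
      f.app a (P.cls a ⟨P.gen x, P.gen_mem_free hx⟩) =
        Q.cls (shiftGrade ε a) ⟨v x, Q.free_mono (shiftGrade_mono ε hx) (v x).2⟩ := by
    intro a x hx
    have nat := congrArg (fun k => k.hom (P.cls (P.grGen x) ⟨P.gen x, P.gen_mem_free le_rfl⟩))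
      (f.naturality (homOfLE hx))
    have key : f.app a (P.cls a ⟨P.gen x, P.gen_mem_free hx⟩) =
        Q.toModule.map (homOfLE (shiftGrade_mono ε hx))
          (f.app (P.grGen x) (P.cls (P.grGen x) ⟨P.gen x, P.gen_mem_free le_rfl⟩)) := nat
    rw [key, ← hv x]
    rfl
  have hf : ∀ (a : Grade n) (u : P.free a), f.app a (P.cls a u) =
      Q.cls (shiftGrade ε a) ⟨P.lift (fun x => (v x : Q.Coeff)) u, hfree a u.2⟩ := by
    intro a
    let A : P.free a →ₗ[F] Q.toModule.obj (shiftGrade ε a) := (f.app a).hom ∘ₗ (P.relIn a).mkQ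
    let B : P.free a →ₗ[F] Q.toModule.obj (shiftGrade ε a) :=
      (Q.relIn (shiftGrade ε a)).mkQ ∘ₗ (P.lift fun x => (v x : Q.Coeff)).restrict (hfree a)
    -- The locus where `A` and `B` agree is pushed into `P.Coeff`, so that it can be tested on
    -- generators there.
    have hAB : P.free a ≤ (LinearMap.eqLocus A B).map (P.free a).subtype :=
      P.free_le_of_gen fun x hx => by
        refine ⟨⟨P.gen x, P.gen_mem_free hx⟩, ?_, rfl⟩
        refine (hgen a x hx).trans (congrArg (Q.cls _) (Subtype.ext ?_))
        exact (P.lift_gen (fun x => (v x : Q.Coeff)) x).symm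
    intro u
    obtain ⟨w, hw, hwu⟩ := hAB u.2
    obtain rfl : w = u := Subtype.ext hwu
    exact hw
  have h : IsShiftMap P Q ε (P.lift fun x => (v x : Q.Coeff)) := by
    refine ⟨fun x => hfree _ (P.gen_mem_free le_rfl), fun r => ?_⟩
    have hr : (P.rel r : P.Coeff) ∈ P.free (P.grRel r) := P.rel_mem r
    -- A relation has class zero, hence so does its image under `f`; this is what puts its lift
    -- among the relations of `Q`.
    have h0 : P.cls (P.grRel r) ⟨P.rel r, hr⟩ = P.cls (P.grRel r) 0 := by
      rw [cls_eq_iff]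
      exact (sub_zero (P.rel r : P.Coeff)).symm ▸ P.rel_mem_relSpan (le_refl (P.grRel r))
    have h1 := hf _ ⟨P.rel r, hr⟩
    rw [h0, hf, cls_eq_iff] at h1
    simpa using h1
  refine ⟨_, h, ?_⟩
  ext a x
  obtain ⟨u, rfl⟩ := P.cls_surjective a x
  exact hf a u

/-- The composite `ψ ∘ φ` is the identity on generators, up to consequences of the relations in
degrees raised by `2ε`. -/
def IsShiftInverse (P Q : Presentation F n) (ε : ℝ) (φ : P.Coeff →ₗ[F] Q.Coeff)
    (ψ : Q.Coeff →ₗ[F] P.Coeff) : Prop :=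
  ∀ x, ψ (φ (P.gen x)) - P.gen x ∈ P.relSpan (shiftGrade ε (shiftGrade ε (P.grGen x)))

theorem IsShiftInverse.sub_mem {ψ : Q.Coeff →ₗ[F] P.Coeff} (h : IsShiftInverse P Q ε φ ψ)
    {a : Grade n} {u : P.Coeff} (hu : u ∈ P.free a) :
    ψ (φ u) - u ∈ P.relSpan (shiftGrade ε (shiftGrade ε a)) := by
  have : P.free a ≤ (P.relSpan (shiftGrade ε (shiftGrade ε a))).comap
      (ψ ∘ₗ φ - LinearMap.id) := P.free_le_of_gen fun x hx =>
    P.relSpan_mono (shiftGrade_mono ε (shiftGrade_mono ε hx)) (h x)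
  exact this hu

theorem isShiftInverse_iff {ε : ℝ≥0} {φ : P.Coeff →ₗ[F] Q.Coeff} {ψ : Q.Coeff →ₗ[F] P.Coeff}
    (hφ : IsShiftMap P Q ε φ) (hψ : IsShiftMap Q P ε ψ) :
    IsShiftInverse P Q ε φ ψ ↔ ∀ a : Grade n, hφ.hom.app a ≫ hψ.hom.app (shiftGrade ε a) =
      P.toModule.map (homOfLE (le_shiftGrade_shiftGrade ε a)) := by
  constructor
  · intro h a
    ext x
    obtain ⟨u, rfl⟩ := P.cls_surjective a x
    exact cls_eq_iff.2 (h.sub_mem u.2)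
  · intro h x
    have := congrArg (fun k => k.hom (P.cls (P.grGen x) ⟨P.gen x, P.gen_mem_free le_rfl⟩))
      (h (P.grGen x))
    exact cls_eq_iff.1 this

/-- Interleavings between presented modules, in terms of coefficient vectors. -/
theorem interleaved_iff {ε : ℝ≥0} : Interleaved ε P.toModule Q.toModule ↔
    ∃ (φ : P.Coeff →ₗ[F] Q.Coeff) (ψ : Q.Coeff →ₗ[F] P.Coeff),
      IsShiftMap P Q ε φ ∧ IsShiftMap Q P ε ψ ∧
      IsShiftInverse P Q ε φ ψ ∧ IsShiftInverse Q P ε ψ φ := by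
  constructor
  · rintro ⟨f, g, hfg, hgf⟩
    obtain ⟨φ, hφ, rfl⟩ := exists_isShiftMap f
    obtain ⟨ψ, hψ, rfl⟩ := exists_isShiftMap g
    exact ⟨φ, ψ, hφ, hψ, (isShiftInverse_iff hφ hψ).2 hfg, (isShiftInverse_iff hψ hφ).2 hgf⟩
  · rintro ⟨φ, ψ, hφ, hψ, h, h'⟩
    exact ⟨hφ.hom, hψ.hom, (isShiftInverse_iff hφ hψ).1 h, (isShiftInverse_iff hψ hφ).1 h'⟩

end Presentation

/-! ### Isomorphisms and `0`-interleavings -/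

section Isomorphism

variable {F : Type u} [Field F] {n : ℕ}

theorem shiftGrade_zero (a : Grade n) : shiftGrade 0 a = a := by
  funext i
  simp [shiftGrade]

theorem shiftGrade_add (δ ε : ℝ) (a : Grade n) :
    shiftGrade δ (shiftGrade ε a) = shiftGrade (ε + δ) a := by
  funext i
  simp only [shiftGrade]
  ring

theorem interleaved_zero_of_iso {M N : PersModule F n} (e : M ≅ N) : Interleaved 0 M N := by
  have hz : ∀ a : Grade n, a ≤ shiftGrade ((0 : ℝ≥0) : ℝ) a := fun a i => by simp [shiftGrade]
  have aux : ∀ {M N : PersModule F n} (e : M ≅ N), ∃ f : M ⟶ translation n ((0 : ℝ≥0) : ℝ) ⋙ N,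
      ∀ a, f.app a = e.hom.app a ≫ N.map (homOfLE (hz a)) := fun {M N} e =>
    ⟨{ app := fun a => e.hom.app a ≫ N.map (homOfLE (hz a))
       naturality := fun a b k => by
        rw [e.hom.naturality_assoc, Category.assoc, Functor.comp_map]
        congr 1
        exact (N.map_comp _ _).symm.trans (N.map_comp (homOfLE (hz a)) _) }, fun _ => rfl⟩
  have aux' : ∀ {M N : PersModule F n} (e : M ≅ N) (a : Grade n),
      (e.hom.app a ≫ N.map (homOfLE (hz a))) ≫ e.inv.app (shiftGrade ((0 : ℝ≥0) : ℝ) a) ≫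
        M.map (homOfLE (hz (shiftGrade ((0 : ℝ≥0) : ℝ) a))) =
      M.map (homOfLE (le_shiftGrade_shiftGrade 0 a)) := fun {M N} e a => by
    rw [Category.assoc, e.inv.naturality_assoc, Iso.hom_inv_id_app_assoc]
    exact (M.map_comp (homOfLE (hz a)) (homOfLE (hz _))).symm
  obtain ⟨f, hf⟩ := aux e
  obtain ⟨g, hg⟩ := aux e.symm
  refine ⟨f, g, fun a => ?_, fun a => ?_⟩
  · rw [hf, hg]
    exact aux' e a
  · rw [hf, hg]
    exact aux' e.symm a

/-- Isomorphisms are `0`-interleavings, and `0 + ε + 0 = ε`. -/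
theorem Interleaved.congr {ε : ℝ≥0} {M M' N N' : PersModule F n} (e : M ≅ M') (e' : N ≅ N')
    (h : Interleaved ε M N) : Interleaved ε M' N' := by
  simpa using ((interleaved_zero_of_iso e.symm).trans h).trans (interleaved_zero_of_iso e')

/-- The identity functor is the translation by `0`. -/
noncomputable def translationZero (M : PersModule F n) :
    translation n ((0 : ℝ≥0) : ℝ) ⋙ M ≅ M :=
  NatIso.ofComponents (fun a => M.mapIso (eqToIso (shiftGrade_zero a))) fun {a b} k => by
    simp only [Functor.comp_map, Functor.mapIso_hom]
    exact (M.map_comp _ _).symm.trans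
      (M.map_comp (eqToHom (shiftGrade_zero a)) k)

theorem Interleaved.iso_of_zero {M N : PersModule F n} (h : Interleaved 0 M N) :
    Nonempty (M ≅ N) := by
  have aux : ∀ {M N : PersModule F n} (f : M ⟶ translation n ((0 : ℝ≥0) : ℝ) ⋙ N)
      (g : N ⟶ translation n ((0 : ℝ≥0) : ℝ) ⋙ M),
      (∀ a : Grade n, f.app a ≫ g.app (shiftGrade ((0 : ℝ≥0) : ℝ) a) =
        M.map (homOfLE (le_shiftGrade_shiftGrade 0 a))) →
      (f ≫ (translationZero N).hom) ≫ g ≫ (translationZero M).hom = 𝟙 M := by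
    intro M N f g h
    ext1
    funext a
    have e : (translationZero N).hom.app a ≫ g.app a = g.app (shiftGrade ((0 : ℝ≥0) : ℝ) a) ≫
        M.map ((translation n ((0 : ℝ≥0) : ℝ)).map (eqToHom (shiftGrade_zero a))) :=
      g.naturality (eqToHom (shiftGrade_zero a))
    rw [NatTrans.comp_app, NatTrans.comp_app, NatTrans.comp_app, Category.assoc, reassoc_of% e,
      reassoc_of% (h a)]
    -- Only structure maps of `M` remain; their composite goes from `a` to `a`, and a poset has just
    -- one such arrow.
    refine Eq.trans ?_ (M.map_id a)
    refine ((M.map_comp_assoc _ _ _).symm.trans (M.map_comp _ _).symm).trans ?_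
    rfl
  obtain ⟨f, g, hfg, hgf⟩ := h
  exact ⟨⟨f ≫ (translationZero N).hom, g ≫ (translationZero M).hom, aux f g hfg, aux g f hgf⟩⟩

end Isomorphism

/-! ### Attainment of the infimum -/

section Closedness

variable {F : Type u} [Field F] {n : ℕ}

open Filter Topology

/-- If the inequality fails at `ε`, it fails strictly in some coordinate, and this persists nearby
by continuity. -/
theorem eventually_shiftGrade_le_imp {f : ℝ → ℝ} {ε : ℝ} (hf : Continuous f) (a b : Grade n) :
    ∀ᶠ δ in 𝓝[>] ε, b ≤ shiftGrade (f δ) a → b ≤ shiftGrade (f ε) a := by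
  by_cases hb : b ≤ shiftGrade (f ε) a
  · exact Eventually.of_forall fun _ _ => hb
  · obtain ⟨i, hi⟩ : ∃ i, ¬ b i ≤ a i + f ε := not_forall.1 hb
    have h : ∀ᶠ δ in 𝓝 ε, a i + f δ < b i :=
      (continuous_const.add hf).continuousAt.eventually_lt continuousAt_const (not_le.1 hi)
    filter_upwards [nhdsWithin_le_nhds h] with δ hδ hle
    exact absurd (hle i) (not_le.2 hδ)

namespace Presentation

theorem eventually_free_le (P : Presentation F n) [Finite P.Gen] {f : ℝ → ℝ} {ε : ℝ}
    (hf : Continuous f) (a : Grade n) :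
    ∀ᶠ δ in 𝓝[>] ε, P.free (shiftGrade (f δ) a) ≤ P.free (shiftGrade (f ε) a) := by
  filter_upwards [eventually_all.2 fun x => eventually_shiftGrade_le_imp hf a (P.grGen x)]
    with δ hδ using free_le_free hδ

theorem eventually_relSpan_le (P : Presentation F n) [Finite P.Rel] {f : ℝ → ℝ} {ε : ℝ}
    (hf : Continuous f) (a : Grade n) :
    ∀ᶠ δ in 𝓝[>] ε, P.relSpan (shiftGrade (f δ) a) ≤ P.relSpan (shiftGrade (f ε) a) := by
  filter_upwards [eventually_all.2 fun x => eventually_shiftGrade_le_imp hf a (P.grRel x)]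
    with δ hδ using relSpan_le_relSpan hδ

variable {P Q : Presentation F n} {φ : P.Coeff →ₗ[F] Q.Coeff} {ψ : Q.Coeff →ₗ[F] P.Coeff}

theorem IsShiftMap.of_le {δ ε : ℝ} (h : IsShiftMap P Q δ φ)
    (hg : ∀ x, Q.free (shiftGrade δ (P.grGen x)) ≤ Q.free (shiftGrade ε (P.grGen x)))
    (hr : ∀ r, Q.relSpan (shiftGrade δ (P.grRel r)) ≤ Q.relSpan (shiftGrade ε (P.grRel r))) :
    IsShiftMap P Q ε φ :=
  ⟨fun x => hg x (h.gen_mem x), fun r => hr r (h.rel_mem r)⟩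

theorem IsShiftInverse.of_le {δ ε : ℝ} (h : IsShiftInverse P Q δ φ ψ)
    (hr : ∀ x, P.relSpan (shiftGrade (δ + δ) (P.grGen x)) ≤
      P.relSpan (shiftGrade (ε + ε) (P.grGen x))) : IsShiftInverse P Q ε φ ψ := fun x => by
  have := h x
  rw [shiftGrade_add] at this ⊢
  exact hr x this

/-- The quantifier over `φ` stands inside: the bound on `δ` depends only on the grades, while the
maps are known only once `δ` is fixed. -/
theorem eventually_isShiftMap_imp (P Q : Presentation F n) [Finite P.Gen] [Finite P.Rel]
    [Finite Q.Gen] [Finite Q.Rel] (ε : ℝ) : ∀ᶠ δ in 𝓝[>] ε, ∀ φ : P.Coeff →ₗ[F] Q.Coeff,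
      IsShiftMap P Q δ φ → IsShiftMap P Q ε φ := by
  filter_upwards [eventually_all.2 fun x => Q.eventually_free_le continuous_id (P.grGen x),
    eventually_all.2 fun r => Q.eventually_relSpan_le continuous_id (P.grRel r)]
    with δ h₁ h₂ φ h using h.of_le h₁ h₂

theorem eventually_isShiftInverse_imp (P Q : Presentation F n) [Finite P.Gen] [Finite P.Rel]
    (ε : ℝ) : ∀ᶠ δ in 𝓝[>] ε, ∀ (φ : P.Coeff →ₗ[F] Q.Coeff) (ψ : Q.Coeff →ₗ[F] P.Coeff),
      IsShiftInverse P Q δ φ ψ → IsShiftInverse P Q ε φ ψ := by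
  filter_upwards [eventually_all.2 fun x =>
    P.eventually_relSpan_le (continuous_id.add continuous_id) (P.grGen x)]
    with δ h₁ φ ψ h using h.of_le h₁

end Presentation

theorem Interleaved.self (η : ℝ≥0) (N : PersModule F n) : Interleaved η N N := by
  have h : ∀ a : Grade n, a ≤ shiftGrade (η : ℝ) a := fun a i => by simp [shiftGrade]
  let k : N ⟶ translation n (η : ℝ) ⋙ N :=
    { app := fun a => N.map (Y := (translation n (η : ℝ)).obj a) (homOfLE (h a))
      naturality := fun a b k => by
        simp only [Functor.comp_map, ← N.map_comp]
        rfl }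
  exact ⟨k, k, fun a => (N.map_comp (homOfLE (h a)) (homOfLE (h _))).symm,
    fun a => (N.map_comp (homOfLE (h a)) (homOfLE (h _))).symm⟩

theorem Interleaved.mono {δ ε : ℝ≥0} {M N : PersModule F n} (h : Interleaved δ M N)
    (hle : δ ≤ ε) : Interleaved ε M N := by
  obtain ⟨η, rfl⟩ := exists_add_of_le hle
  exact h.trans (Interleaved.self η N)

/-- The infimum in the definition of the interleaving distance is attained. -/
theorem interleaved_of_interleavingDist_le {M N : PersModule F n} (hM : isFinitelyPresented F n M)
    (hN : isFinitelyPresented F n N) {ε : ℝ≥0} (h : interleavingDist M N ≤ ε) :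
    Interleaved ε M N := by
  obtain ⟨P, _, _, ⟨eP⟩⟩ := hM
  obtain ⟨Q, _, _, ⟨eQ⟩⟩ := hN
  refine Interleaved.congr eP.symm eQ.symm ?_
  -- Right neighbourhoods of `ε` are nonempty, so one `δ > ε` serves all four conditions.
  obtain ⟨δ, hδ, h₁, h₂, h₃, h₄⟩ := (eventually_mem_nhdsWithin.and
    ((Presentation.eventually_isShiftMap_imp P Q ε).and
    ((Presentation.eventually_isShiftMap_imp Q P ε).and
    ((Presentation.eventually_isShiftInverse_imp P Q ε).and
    (Presentation.eventually_isShiftInverse_imp Q P ε))))).exists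
  have hεδ : (ε : ℝ) < δ := hδ
  lift δ to ℝ≥0 using ε.coe_nonneg.trans hεδ.le
  have hlt : interleavingDist M N < δ := h.trans_lt (by exact_mod_cast hεδ)
  simp only [interleavingDist, iInf_lt_iff] at hlt
  obtain ⟨η, hη, hηδ⟩ := hlt
  obtain ⟨φ, ψ, a₁, a₂, a₃, a₄⟩ := Presentation.interleaved_iff.1
    ((hη.mono (by exact_mod_cast hηδ.le)).congr eP eQ)
  exact Presentation.interleaved_iff.2 ⟨φ, ψ, h₁ φ a₁, h₂ ψ a₂, h₃ φ ψ a₃, h₄ ψ φ a₄⟩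

end Closedness

/-! ### Interleavings between interpolated presentations -/

section Interpolation

variable {F : Type u} [Field F] {n : ℕ}

theorem Presentation.sub_self_mem (a : Grade n) (P : Presentation F n) (u : P.Coeff) :
    u - u ∈ P.relSpan a :=
  (sub_self u).symm ▸ Submodule.zero_mem _

namespace JointPresentation

/-- From `s` to `t`, grades on the `M` side move by `(t - s)ε` and those on the `N` side by `(s -
t)ε`. Both are at most `δ`, so the identity on coefficients works in both directions. -/
theorem interpolate_interleaved {ε : ℝ≥0} (D : JointPresentation F n ε) {s t : I} {δ : ℝ≥0}
    (h : |(s : ℝ) - t| * ε ≤ δ) :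
    Interleaved δ (D.interpolate s).toModule (D.interpolate t).toModule := by
  have key : ∀ {s t : I}, |(s : ℝ) - t| * ε ≤ δ →
      Presentation.IsShiftMap (D.interpolate s) (D.interpolate t) δ LinearMap.id := by
    intro s t h
    have h₁ : ((t : ℝ) - s) * ε ≤ δ := (mul_le_mul_of_nonneg_right
      ((neg_sub (s : ℝ) t).symm.le.trans (neg_le_abs _)) ε.coe_nonneg).trans h
    have h₂ : ((s : ℝ) - t) * ε ≤ δ := (mul_le_mul_of_nonneg_right
      (le_abs_self _) ε.coe_nonneg).trans h
    constructor
    · intro x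
      refine (D.interpolate t).gen_mem_free (x := x) ?_
      rcases x with x | x <;> intro i <;>
        simp only [interpolate, Sum.elim_inl, Sum.elim_inr, shiftGrade] <;> linarith
    · intro r
      refine (D.interpolate t).rel_mem_relSpan (r := r) ?_
      rcases r with x | x <;> intro i <;>
        simp only [interpolate, Sum.elim_inl, Sum.elim_inr, shiftGrade] <;> linarith
  refine Presentation.interleaved_iff.2 ⟨LinearMap.id, LinearMap.id, key h,
    key (by rwa [abs_sub_comm]), fun x => ?_, fun x => ?_⟩
  · exact Presentation.sub_self_mem _ (D.interpolate s) _
  · exact Presentation.sub_self_mem _ (D.interpolate t) _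

end JointPresentation

end Interpolation

/-! ### The joint presentation and its endpoints -/

section Joint

variable {F : Type u} [Field F] {n : ℕ}

namespace Presentation

theorem iso_of_maps {P R : Presentation F n} (α : P.Coeff →ₗ[F] R.Coeff)
    (β : R.Coeff →ₗ[F] P.Coeff) (hα : ∀ x, α (P.gen x) ∈ R.free (P.grGen x))
    (hα' : ∀ r, α (P.rel r) ∈ R.relSpan (P.grRel r)) (hβ : ∀ z, β (R.gen z) ∈ P.free (R.grGen z))
    (hβ' : ∀ r, β (R.rel r) ∈ P.relSpan (R.grRel r)) (hβα : ∀ x, β (α (P.gen x)) = P.gen x)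
    (hαβ : ∀ z, α (β (R.gen z)) - R.gen z ∈ R.relSpan (R.grGen z)) :
    Nonempty (P.toModule ≅ R.toModule) := by
  have h0 : ∀ a : Grade n, shiftGrade ((0 : ℝ≥0) : ℝ) a = a := shiftGrade_zero
  refine Interleaved.iso_of_zero (interleaved_iff.2 ⟨α, β, ⟨?_, ?_⟩, ⟨?_, ?_⟩, ?_, ?_⟩)
  · simpa only [h0]
  · simpa only [h0]
  · simpa only [h0]
  · simpa only [h0]
  · intro x
    rw [hβα]
    exact sub_self_mem _ P _
  · intro z
    simpa only [h0] using hαβ z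

variable (P Q : Presentation F n)

/-- The inclusion of the coefficient vectors of `P` in those on the generators of `P` and `Q`. -/
noncomputable def inl : P.Coeff →ₗ[F] ((P.Gen ⊕ Q.Gen) →₀ F) :=
  P.lift fun x => Finsupp.single (Sum.inl x) 1

/-- The inclusion of the coefficient vectors of `Q` in those on the generators of `P` and `Q`. -/
noncomputable def inr : Q.Coeff →ₗ[F] ((P.Gen ⊕ Q.Gen) →₀ F) :=
  Q.lift fun x => Finsupp.single (Sum.inr x) 1

variable {P Q}

theorem inl_gen (x : P.Gen) : inl P Q (P.gen x) = Finsupp.single (Sum.inl x) 1 :=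
  P.lift_gen _ x

theorem inr_gen (y : Q.Gen) : inr P Q (Q.gen y) = Finsupp.single (Sum.inr y) 1 :=
  Q.lift_gen _ y

theorem inl_mem {S : Set (P.Gen ⊕ Q.Gen)} {a : Grade n} (hS : ∀ x, P.grGen x ≤ a → Sum.inl x ∈ S)
    {u : P.Coeff} (hu : u ∈ P.free a) : inl P Q u ∈ Finsupp.supported F F S := by
  have : P.free a ≤ (Finsupp.supported F F S).comap (inl P Q) := P.free_le_of_gen fun x hx => by
    rw [Submodule.mem_comap, inl_gen]
    exact Finsupp.single_mem_supported F _ (hS x hx)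
  exact this hu

theorem inr_mem {S : Set (P.Gen ⊕ Q.Gen)} {a : Grade n} (hS : ∀ x, Q.grGen x ≤ a → Sum.inr x ∈ S)
    {u : Q.Coeff} (hu : u ∈ Q.free a) : inr P Q u ∈ Finsupp.supported F F S := by
  have : Q.free a ≤ (Finsupp.supported F F S).comap (inr P Q) := Q.free_le_of_gen fun x hx => by
    rw [Submodule.mem_comap, inr_gen]
    exact Finsupp.single_mem_supported F _ (hS x hx)
  exact this hu

theorem coeff_hom_ext {V : Type*} [AddCommGroup V] [Module F V] {f g : P.Coeff →ₗ[F] V}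
    (h : ∀ x, f (P.gen x) = g (P.gen x)) : f = g := by
  have : ∀ {f g : (P.Gen →₀ F) →ₗ[F] V},
      (∀ x, f (Finsupp.single x 1) = g (Finsupp.single x 1)) → f = g := fun h =>
    Finsupp.lhom_ext' fun x => LinearMap.ext_ring (h x)
  exact this h

/-- The joint presentation obtained from the two morphisms of an interleaving: each generator is
identified with its image under the respective morphism. -/
noncomputable def joint {ε : ℝ≥0} {φ : P.Coeff →ₗ[F] Q.Coeff} {ψ : Q.Coeff →ₗ[F] P.Coeff}
    (hφ : IsShiftMap P Q ε φ) (hψ : IsShiftMap Q P ε ψ) : JointPresentation F n ε where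
  GenM := P.Gen
  GenN := Q.Gen
  -- `y - ψ y` belongs to the `M` side: in `Free[X_M ⊔ X_N(-ε)]` both terms live in the grade of `y`
  -- raised by `ε`.
  RelM := P.Rel ⊕ Q.Gen
  RelN := Q.Rel ⊕ P.Gen
  grGenM := P.grGen
  grGenN := Q.grGen
  grRelM := Sum.elim P.grRel fun y => shiftGrade ε (Q.grGen y)
  grRelN := Sum.elim Q.grRel fun x => shiftGrade ε (P.grGen x)
  relM := Sum.elim (fun r => inl P Q (P.rel r)) fun y => inr P Q (Q.gen y) - inl P Q (ψ (Q.gen y))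
  relN := Sum.elim (fun r => inr P Q (Q.rel r)) fun x => inl P Q (P.gen x) - inr P Q (φ (P.gen x))
  relM_mem := by
    rintro (r | y)
    · exact inl_mem (fun x hx => hx) (P.rel_mem r)
    · refine sub_mem (inr_mem (fun x hx => ?_) (Q.gen_mem_free le_rfl))
        (inl_mem (fun x hx => hx) (hψ.gen_mem y))
      exact shiftGrade_mono ε hx
  relN_mem := by
    rintro (r | y)
    · exact inr_mem (fun x hx => hx) (Q.rel_mem r)
    · refine sub_mem (inl_mem (fun x hx => ?_) (P.gen_mem_free le_rfl))
        (inr_mem (fun x hx => hx) (hφ.gen_mem y))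
      exact shiftGrade_mono ε hx

/-- A presentation with the generators and relations of `P` and `Q` in which the generators of `Q`
are identified with their images in `P`, and those of `P` with their images in `Q` in degrees
raised by `2ε`, presents the same module as `P`. -/
theorem iso_of_elimination {P Q R : Presentation F n} {ε : ℝ} {φ : P.Coeff →ₗ[F] Q.Coeff}
    {ψ : Q.Coeff →ₗ[F] P.Coeff} (hψ : IsShiftMap Q P ε ψ) (h : IsShiftInverse P Q ε φ ψ)
    (i : P.Coeff →ₗ[F] R.Coeff) (j : Q.Coeff →ₗ[F] R.Coeff) (e : P.Gen ⊕ Q.Gen ≃ R.Gen)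
    (k : (P.Rel ⊕ Q.Gen) ⊕ (Q.Rel ⊕ P.Gen) ≃ R.Rel)
    (hi : ∀ x, i (P.gen x) = R.gen (e (Sum.inl x))) (hj : ∀ y, j (Q.gen y) = R.gen (e (Sum.inr y)))
    (el : ∀ x, R.grGen (e (Sum.inl x)) = P.grGen x)
    (er : ∀ y, R.grGen (e (Sum.inr y)) = shiftGrade ε (Q.grGen y))
    (k₁ : ∀ r, (R.rel (k (Sum.inl (Sum.inl r))) : R.Coeff) = i (P.rel r))
    (k₂ : ∀ y, (R.rel (k (Sum.inl (Sum.inr y))) : R.Coeff) = j (Q.gen y) - i (ψ (Q.gen y)))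
    (k₃ : ∀ r, (R.rel (k (Sum.inr (Sum.inl r))) : R.Coeff) = j (Q.rel r))
    (k₄ : ∀ x, (R.rel (k (Sum.inr (Sum.inr x))) : R.Coeff) = i (P.gen x) - j (φ (P.gen x)))
    (g₁ : ∀ r, R.grRel (k (Sum.inl (Sum.inl r))) = P.grRel r)
    (g₂ : ∀ y, R.grRel (k (Sum.inl (Sum.inr y))) = shiftGrade ε (Q.grGen y))
    (g₃ : ∀ r, R.grRel (k (Sum.inr (Sum.inl r))) = shiftGrade ε (Q.grRel r))
    (g₄ : ∀ x, R.grRel (k (Sum.inr (Sum.inr x))) = shiftGrade ε (shiftGrade ε (P.grGen x))) :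
    Nonempty (P.toModule ≅ R.toModule) := by
  -- The elimination: `β` fixes the generators of `P` and replaces each `y` by `ψ y`.
  let β : R.Coeff →ₗ[F] P.Coeff :=
    R.lift fun z => Sum.elim P.gen (fun y => ψ (Q.gen y)) (e.symm z)
  have βi : β ∘ₗ i = LinearMap.id := coeff_hom_ext fun x => by
    rw [LinearMap.comp_apply, hi, lift_gen, Equiv.symm_apply_apply, Sum.elim_inl,
      LinearMap.id_apply]
  have βj : β ∘ₗ j = ψ := coeff_hom_ext fun x => by
    rw [LinearMap.comp_apply, hj, lift_gen, Equiv.symm_apply_apply, Sum.elim_inr]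
  replace βi : ∀ u, β (i u) = u := fun u => LinearMap.congr_fun βi u
  replace βj : ∀ u, β (j u) = ψ u := fun u => LinearMap.congr_fun βj u
  refine iso_of_maps i β ?_ ?_ ?_ ?_ ?_ ?_
  · intro x
    rw [hi]
    exact R.gen_mem_free (el x).le
  · intro r
    rw [← k₁]
    exact R.rel_mem_relSpan (g₁ r).le
  · intro z
    obtain ⟨x | y, rfl⟩ := e.surjective z
    · rw [← hi, βi, el]
      exact P.gen_mem_free le_rfl
    · rw [← hj, βj, er]
      exact hψ.gen_mem y
  · intro r
    obtain ⟨(r | y) | (r | x), rfl⟩ := k.surjective r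
    · rw [k₁, g₁]
      exact (βi (P.rel r)).symm ▸ P.rel_mem_relSpan le_rfl
    · rw [k₂, map_sub, βi, βj, sub_self]
      exact Submodule.zero_mem _
    · rw [k₃, g₃]
      exact (βj (Q.rel r)).symm ▸ hψ.rel_mem r
    -- Under `β` the relation becomes `x - ψ (φ x)`, which vanishes modulo relations exactly in
    -- grades raised by `2ε`.
    · rw [k₄, g₄, map_sub, βi, βj, ← neg_sub]
      exact neg_mem (h x)
  · exact fun x => βi _
  · intro z
    obtain ⟨x | y, rfl⟩ := e.surjective z
    · rw [← hi, βi]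
      exact sub_self_mem _ R _
    -- The difference `i (ψ y) - j y` is the negative of an imposed relation, available in the very
    -- grade of `y`.
    · rw [← hj, βj, ← neg_sub, ← k₂]
      exact neg_mem (R.rel_mem_relSpan ((g₂ y).trans (er y).symm).le)

section Endpoints

variable {ε : ℝ≥0} {φ : P.Coeff →ₗ[F] Q.Coeff} {ψ : Q.Coeff →ₗ[F] P.Coeff}
  (hφ : IsShiftMap P Q ε φ) (hψ : IsShiftMap Q P ε ψ)

theorem joint_interpolate_zero (h : IsShiftInverse P Q ε φ ψ) :
    Nonempty (P.toModule ≅ ((joint hφ hψ).interpolate 0).toModule) := by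
  have e₀ : ∀ a : Grade n, shiftGrade (((0 : I) : ℝ) * ε) a = a := fun a => by
    simp [shiftGrade_zero]
  have e₁ : ∀ a : Grade n, shiftGrade ((1 - ((0 : I) : ℝ)) * ε) a = shiftGrade ε a := fun a => by
    simp
  let i : P.Coeff →ₗ[F] ((joint hφ hψ).interpolate 0).Coeff := inl P Q
  let j : Q.Coeff →ₗ[F] ((joint hφ hψ).interpolate 0).Coeff := inr P Q
  exact iso_of_elimination hψ h i j (Equiv.refl _) (Equiv.refl _)
    inl_gen inr_gen (fun x => e₀ _) (fun y => e₁ _)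
    (fun r => rfl) (fun y => rfl) (fun r => rfl) (fun x => rfl)
    (fun r => e₀ _) (fun y => e₀ _) (fun r => e₁ _) (fun x => e₁ _)

theorem joint_interpolate_one (h : IsShiftInverse Q P ε ψ φ) :
    Nonempty (Q.toModule ≅ ((joint hφ hψ).interpolate 1).toModule) := by
  have e₀ : ∀ a : Grade n, shiftGrade ((1 - ((1 : I) : ℝ)) * ε) a = a := fun a => by
    simp [shiftGrade_zero]
  have e₁ : ∀ a : Grade n, shiftGrade (((1 : I) : ℝ) * ε) a = shiftGrade ε a := fun a => by
    simp
  let i : Q.Coeff →ₗ[F] ((joint hφ hψ).interpolate 1).Coeff := inr P Q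
  let j : P.Coeff →ₗ[F] ((joint hφ hψ).interpolate 1).Coeff := inl P Q
  -- At time `1` the two modules exchange roles, so the generators and relations are swapped.
  exact iso_of_elimination hφ h i j (Equiv.sumComm _ _) (Equiv.sumComm _ _)
    inr_gen inl_gen (fun x => e₀ _) (fun y => e₁ _)
    (fun r => rfl) (fun y => rfl) (fun r => rfl) (fun x => rfl)
    (fun r => e₀ _) (fun y => e₀ _) (fun r => e₁ _) (fun x => e₁ _)

end Endpoints

end Presentation

end Joint

/-! ### Geodesics -/

section Geodesic

variable {F : Type u} [Field F] {n : ℕ}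

theorem edist_le_of_interleaved {M N : FinPresModule F n} {ε : ℝ≥0}
    (h : Interleaved ε M.obj N.obj) : edist M N ≤ ε :=
  iInf₂_le ε h

theorem edist_le_pathLength {X : Type*} [PseudoEMetricSpace X] {x y : X} (γ : Path x y) :
    edist x y ≤ pathLength γ := by
  simpa [pathLength] using eVariationOn.edist_le γ (Set.mem_univ (0 : I)) (Set.mem_univ (1 : I))

/-- Each sum is at most `K` times the corresponding sum for the inclusion of `[0,1]` in the reals,
whose variation is at most `1` by monotonicity. -/
theorem pathLength_le_of_lipschitzWith {X : Type*} [PseudoEMetricSpace X] {x y : X}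
    {γ : Path x y} {K : ℝ≥0} (h : LipschitzWith K γ) : pathLength γ ≤ K := by
  have h₁ : eVariationOn γ Set.univ ≤ K * eVariationOn (fun t : I => (t : ℝ)) Set.univ :=
    iSup_le fun p => by
      refine le_trans ?_ (mul_le_mul_right
        (eVariationOn.sum_le (f := fun t : I => (t : ℝ)) (n := p.1) p.2.2.1 p.2.2.2) (K : ℝ≥0∞))
      rw [Finset.mul_sum]
      exact Finset.sum_le_sum fun i _ => h _ _
  have h₂ : eVariationOn (fun t : I => (t : ℝ)) Set.univ ≤ 1 := by
    have hm : MonotoneOn (fun t : I => (t : ℝ)) Set.univ := fun a _ b _ hab => hab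
    have := hm.eVariationOn_eq (Set.mem_univ 0) (Set.mem_univ 1)
    rw [Set.univ_inter, show Set.Icc (0 : I) 1 = Set.univ from Set.Icc_bot_top] at this
    simp [this]
  exact h₁.trans ((mul_le_mul_right h₂ _).trans_eq (mul_one _))

theorem exists_path {M N : FinPresModule F n} {ε : ℝ≥0} (h : edist M N = ε) :
    ∃ γ : Path M N, pathLength γ = ε ∧
      ∃ D : JointPresentation F n ε,
        Finite D.GenM ∧ Finite D.GenN ∧ Finite D.RelM ∧ Finite D.RelN ∧
        ∀ t : I, Nonempty ((γ t).obj ≅ (D.interpolate t).toModule) := by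
  have hI : Interleaved ε M.obj N.obj :=
    interleaved_of_interleavingDist_le M.property N.property h.le
  obtain ⟨P, _, _, ⟨eP⟩⟩ := M.property
  obtain ⟨Q, _, _, ⟨eQ⟩⟩ := N.property
  obtain ⟨φ, ψ, hφ, hψ, hφψ, hψφ⟩ := Presentation.interleaved_iff.1 (hI.congr eP eQ)
  obtain ⟨e₀⟩ := Presentation.joint_interpolate_zero hφ hψ hφψ
  obtain ⟨e₁⟩ := Presentation.joint_interpolate_one hφ hψ hψφ
  let D := Presentation.joint hφ hψ
  have hg : Finite (P.Gen ⊕ Q.Gen) := inferInstance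
  have hr : Finite ((P.Rel ⊕ Q.Gen) ⊕ (Q.Rel ⊕ P.Gen)) := inferInstance
  classical
  -- A path must end at `M` and `N` themselves, while the interpolation reaches them only up to
  -- isomorphism. Overriding the endpoints costs no distance.
  let γ : I → FinPresModule F n := fun t => if t = 0 then M else if t = 1 then N else
    ⟨(D.interpolate t).toModule, D.interpolate t, hg, hr, ⟨Iso.refl _⟩⟩
  have hγ : ∀ t, Nonempty ((γ t).obj ≅ (D.interpolate t).toModule) := by
    intro t
    by_cases h0 : t = 0
    · subst h0
      simp only [γ, if_true]
      exact ⟨eP ≪≫ e₀⟩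
    by_cases h1 : t = 1
    · subst h1
      simp only [γ, if_neg h0, if_true]
      exact ⟨eQ ≪≫ e₁⟩
    · simp only [γ, if_neg h0, if_neg h1]
      exact ⟨Iso.refl _⟩
  have hL : LipschitzWith ε γ := fun s t => by
    obtain ⟨es⟩ := hγ s
    obtain ⟨et⟩ := hγ t
    have : ((ε * nndist s t : ℝ≥0) : ℝ≥0∞) = ε * edist s t := by
      rw [ENNReal.coe_mul, edist_nndist]
    rw [← this]
    refine edist_le_of_interleaved ((D.interpolate_interleaved ?_).congr es.symm et.symm)
    rw [mul_comm, NNReal.coe_mul, coe_nndist, Subtype.dist_eq, Real.dist_eq]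
  let p : Path M N := ⟨⟨γ, hL.continuous⟩, by simp [γ], by simp [γ]⟩
  -- The Lipschitz constant bounds the length above, the distance of the endpoints below.
  exact ⟨p, le_antisymm (pathLength_le_of_lipschitzWith (γ := p) hL) (h ▸ edist_le_pathLength p),
    D, ‹_›, ‹_›, inferInstanceAs (Finite (P.Rel ⊕ Q.Gen)),
    inferInstanceAs (Finite (Q.Rel ⊕ P.Gen)), hγ⟩

end Geodesic

theorem mainTheorem2 (F : Type u) [Field F] (n : ℕ) :
    (∀ M N : FinPresModule F n, edist M N = 0 ↔ Nonempty (M ≅ N)) ∧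
    IsPathMetric (FinPresModule F n) ∧
    (∀ (M N : FinPresModule F n) (ε : ℝ≥0), edist M N = ε →
      ∃ γ : Path M N, pathLength γ = ε ∧
        ∃ D : JointPresentation F n ε,
          Finite D.GenM ∧ Finite D.GenN ∧ Finite D.RelM ∧ Finite D.RelN ∧
          ∀ t : I, Nonempty ((γ t).obj ≅ (D.interpolate t).toModule)) := by
  refine ⟨fun M N => ⟨fun h => ?_, fun ⟨e⟩ => ?_⟩, fun M N => ?_, fun M N ε => exists_path⟩
  · obtain ⟨e⟩ := (interleaved_of_interleavingDist_le (ε := 0) M.property N.property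
      (h.le.trans_eq ENNReal.coe_zero.symm)).iso_of_zero
    exact ⟨(isFinitelyPresented F n).isoMk e⟩
  · simpa using edist_le_of_interleaved
      (interleaved_zero_of_iso ((isFinitelyPresented F n).ι.mapIso e))
  · refine le_antisymm (le_iInf edist_le_pathLength) ?_
    -- At infinite distance the bound is trivial; otherwise a geodesic attains the infimum.
    by_cases h : edist M N = ⊤
    · exact h ▸ le_top
    · obtain ⟨γ, hγ, -⟩ := exists_path (ENNReal.coe_toNNReal h).symm
      exact (iInf_le _ γ).trans (hγ.trans (ENNReal.coe_toNNReal h)).le
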